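/- Let $n \ge 0$, let $\mathrm{Sym}(n)$ be the vector space of real symmetric $n\times n$ matrices, of dimension $m = n(n+1)/2$, and let $\mathrm{SPD}(n) \subset \mathrm{Sym}(n)$ be the open subset of positive definite matrices, with its affine-invariant Riemannian metric $\langle V, W\rangle_P = \operatorname{Tr}(P^{-1}VP^{-1}W)$. Its Riemannian distance and logarithm are given by $$d(P,Q)^2 = \operatorname{Tr}\big(\log(P^{-1/2}QP^{-1/2})^2\big), \qquad \log_P Q = P^{1/2}\log(P^{-1/2}QP^{-1/2})P^{1/2} \in \mathrm{Sym}(n).$$ For reference points $R = (R_1,\dots,R_\ell) \in \mathrm{SPD}(n)^\ell$ let $$F_R : \mathrm{SPD}(n) \to \mathbb{R}^\ell, \qquad F_R(P) = \big(d(R_1,P)^2,\dots,d(R_\ell,P)^2\big)$$ be the squared Fréchet map, let $\Gamma_R$ be the set of all $P \in \mathrm{SPD}(n)$ such that $(\log_P R_1,\dots,\log_P R_\ell)$ has rank $m$ (i.e. spans an $m$-dimensional space), and let $S_R = \mathrm{SPD}(n)\setminus\Gamma_R$ be the rank-deficient set. **Theorem.** Suppose that $\ell \ge 2m$. Then for almost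 every $R \in \mathrm{SPD}(n)^\ell$ (with respect to the product Lebesgue measure of $\mathrm{Sym}(n)^\ell$) one has $S_R = \emptyset$. In other words, $F_R$ is then locally invertible on $\mathrm{SPD}(n)$: at every $P \in \mathrm{SPD}(n)$ the map $F_R$ is differentiable with differential $DF_R(P) : \mathrm{Sym}(n) \to \mathbb{R}^\ell$ of rank $m$, and $F_R$ restricts to a smooth ($C^\infty$) diffeomorphism from an open neighbourhood of $P$ onto the image of that neighbourhood. -/

import Mathlib

open scoped Matrix ContDiff
open MeasureTheory

/-- The square root of a positive (semi)definite matrix. -/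
noncomputable def matSqrt {n : ℕ} (A : Matrix (Fin n) (Fin n) ℝ) : Matrix (Fin n) (Fin n) ℝ :=
  cfc Real.sqrt A

/-- The logarithm of a symmetric positive definite matrix. -/
noncomputable def matLog {n : ℕ} (A : Matrix (Fin n) (Fin n) ℝ) : Matrix (Fin n) (Fin n) ℝ :=
  cfc Real.log A

/-- `log (P^{-1/2} Q P^{-1/2})`. -/
noncomputable def relLog {n : ℕ} (P Q : Matrix (Fin n) (Fin n) ℝ) : Matrix (Fin n) (Fin n) ℝ :=
  matLog ((matSqrt P)⁻¹ * Q * (matSqrt P)⁻¹)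

theorem isSymm_logMap {n : ℕ} (P Q : Matrix (Fin n) (Fin n) ℝ) :
    (matSqrt P * relLog P Q * matSqrt P).IsSymm := by
  have h1 : (matSqrt P)ᵀ = matSqrt P := by
    rw [← Matrix.conjTranspose_eq_transpose_of_trivial]
    exact (cfc_predicate Real.sqrt P : IsSelfAdjoint (matSqrt P)).star_eq
  have h2 : (relLog P Q)ᵀ = relLog P Q := by
    rw [← Matrix.conjTranspose_eq_transpose_of_trivial]
    exact (cfc_predicate Real.log ((matSqrt P)⁻¹ * Q * (matSqrt P)⁻¹) :
      IsSelfAdjoint (relLog P Q)).star_eq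
  rw [Matrix.IsSymm, Matrix.transpose_mul, Matrix.transpose_mul, h1, h2, mul_assoc]

open scoped Matrix.Norms.Frobenius

/-- `Sym(n)`: the real vector space of symmetric real `n × n` matrices. It carries the (Frobenius)
norm, topology and Borel σ-algebra inherited from the space of matrices. -/
def SymMat (n : ℕ) : Submodule ℝ (Matrix (Fin n) (Fin n) ℝ) where
  carrier := {A | A.IsSymm}
  add_mem' hA hB := hA.add hB
  zero_mem' := Matrix.isSymm_zero
  smul_mem' c _ hA := hA.smul c

instance (n : ℕ) : MeasurableSpace (SymMat n) := borel (SymMat n)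

instance (n : ℕ) : BorelSpace (SymMat n) := ⟨rfl⟩

/-- `SPD(n)`: the symmetric positive definite matrices, an (open) subset of `Sym(n)`. -/
def SPD (n : ℕ) : Set (SymMat n) := {P | (P : Matrix (Fin n) (Fin n) ℝ).PosDef}

/-- The symmetric matrix with prescribed entries `v {i, j}` at the positions `(i, j)`, `(j, i)`. -/
def symOfEntries (n : ℕ) (v : Sym2 (Fin n) → ℝ) : SymMat n :=
  ⟨Matrix.of fun i j => v s(i, j), Matrix.IsSymm.ext fun i j => by simp [Sym2.eq_swap]⟩

/-- Lebesgue measure on `Sym(n)`: the image of the Lebesgue measure of `ℝ^{n(n+1)/2}` when a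
symmetric matrix is described by its entries in the positions `{i, j}`. -/
noncomputable def lebesgueSym (n : ℕ) : Measure (SymMat n) :=
  Measure.map (symOfEntries n) volume

/-- The affine-invariant Riemannian distance on `SPD(n)`:
`d(P, Q)² = Tr (log (P^{-1/2} Q P^{-1/2})²)`. -/
noncomputable def spdDist {n : ℕ} (P Q : SymMat n) : ℝ :=
  Real.sqrt (Matrix.trace (relLog (P : Matrix (Fin n) (Fin n) ℝ) Q ^ 2))

/-- The Riemannian logarithm `log_P Q = P^{1/2} log (P^{-1/2} Q P^{-1/2}) P^{1/2}`, a tangent vector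
at `P`, i.e. an element of `Sym(n)`. -/
noncomputable def logMap {n : ℕ} (P Q : SymMat n) : SymMat n :=
  ⟨matSqrt (P : Matrix (Fin n) (Fin n) ℝ) * relLog (P : Matrix (Fin n) (Fin n) ℝ) Q *
      matSqrt (P : Matrix (Fin n) (Fin n) ℝ), isSymm_logMap _ _⟩

/-- The squared Fréchet map `F(P) = (d(R₁, P)², …, d(R_ℓ, P)²)`. -/
noncomputable def frechetMap {n ℓ : ℕ} (R : Fin ℓ → SymMat n) (P : SymMat n) : Fin ℓ → ℝ :=
  fun i => spdDist (R i) P ^ 2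

/-- `Γ_R`: the points `P` at which `(log_P R₁, …, log_P R_ℓ)` has rank `m = n(n+1)/2`. -/
def fullRankSet {n ℓ : ℕ} (R : Fin ℓ → SymMat n) : Set (SymMat n) :=
  {P ∈ SPD n | Module.finrank ℝ (Submodule.span ℝ (Set.range fun i => logMap P (R i))) =
    n * (n + 1) / 2}

/-- `S_R`: the complement of `Γ_R` in `SPD(n)`. -/
def rankDeficientSet {n ℓ : ℕ} (R : Fin ℓ → SymMat n) : Set (SymMat n) :=
  SPD n \ fullRankSet R

/-- `F` restricts to a (smooth) diffeomorphism from an open neighbourhood `U ⊆ Ω` of `x` onto the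
image `F(U)`: it is smooth and injective on `U`, and the inverse `F(U) → U` is the restriction of a
smooth map defined on an open set containing `F(U)`. -/
def IsLocalDiffeoOntoImageAt {E G : Type*} [NormedAddCommGroup E] [NormedSpace ℝ E]
    [NormedAddCommGroup G] [NormedSpace ℝ G] (F : E → G) (Ω : Set E) (x : E) : Prop :=
  ∃ U : Set E, IsOpen U ∧ x ∈ U ∧ U ⊆ Ω ∧ ContDiffOn ℝ ∞ F U ∧
    ∃ (V : Set G) (g : G → E), IsOpen V ∧ F '' U ⊆ V ∧ ContDiffOn ℝ ∞ g V ∧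
      ∀ y ∈ U, g (F y) = y

/-- `F` is locally invertible at `P`: it is differentiable at `P` with differential of rank
`m = n(n+1)/2`, and it is a diffeomorphism from some neighbourhood of `P` in `SPD(n)` onto the image
of that neighbourhood. -/
def IsLocallyInvertibleAt {n ℓ : ℕ} (F : SymMat n → Fin ℓ → ℝ) (P : SymMat n) : Prop :=
  DifferentiableAt ℝ F P ∧
    Module.finrank ℝ (fderiv ℝ F P).toLinearMap.range = n * (n + 1) / 2 ∧
    IsLocalDiffeoOntoImageAt F (SPD n) P

/-!
The rank condition `S_R = ∅` says that at no `P` do the vectors `log_P R_i` lie in a common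
hyperplane of `Sym(n)`. A configuration `R` violating it has the form `R_i = exp_P v_i` with all
`v_i` in one hyperplane, and so it is determined by `P` (`m` parameters), the hyperplane (`m - 1`
parameters) and `ℓ` points of the hyperplane (`ℓ (m - 1)` parameters). For `ℓ ≥ 2 m` these are fewer
than the `ℓ m` dimensions of `Sym(n)^ℓ`, and a differentiable image of a space of smaller dimension
is Lebesgue null (`addHaar_image_eq_zero_of_finrank_lt`, `ae_span_logMap_eq_top`). Writing the
Riemannian exponential as `exp_P V = P exp (P⁻¹ V)` makes the differentiability of the
parametrization evident, as no matrix square roots occur (`mul_exp_inv_mul_log`).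

For the differential, put `φ X = Tr ((log X)²)`, so that `d(R, P)² = φ (R^{-1/2} P R^{-1/2})`.
The logarithm is smooth on `SPD(n)` by the inverse function theorem for `exp` on `Sym(n)`, whose
derivative is injective: differentiating `X exp X = exp X X` shows that a vector in the kernel at
`S` commutes with `S`, and on such vectors the derivative is multiplication by `exp S`
(`derivExp_injective`). Together with `Tr (C D exp_S V) = Tr (C exp S V)` for `C` commuting with `S`
(`trace_mul_derivExp`), this gives `Dφ(X) W = 2 Tr (X⁻¹ log X W)`, and then that the Riemannian
gradient of `d(R, ·)²` is `-2 log_P R` (`fderiv_spdDist_sq`). Hence `DF_R(P)` is injective as soon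
as the `log_P R_i` span `Sym(n)`, and the immersion theorem
(`isLocalDiffeoOntoImageAt_of_injective_fderiv`) gives the local inverse.
-/

/-! ### Exponential, logarithm and square root of symmetric matrices -/

section MatrixAlgebra

variable {n : ℕ} {A B K P Q : Matrix (Fin n) (Fin n) ℝ}

theorem cfc_exp_eq_exp (hA : A.IsHermitian) : cfc Real.exp A = NormedSpace.exp A :=
  -- The functional calculus instance is stated for the entrywise topology, which instance search
  -- does not identify with that of the Frobenius norm.
  @CFC.real_exp_eq_normedSpace_exp (Matrix (Fin n) (Fin n) ℝ) _ _ _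
    Matrix.IsHermitian.instContinuousFunctionalCalculus _ hA

theorem spectrum_pos_of_posDef (hA : A.PosDef) {x : ℝ} (hx : x ∈ spectrum ℝ A) : 0 < x := by
  rw [hA.1.spectrum_real_eq_range_eigenvalues] at hx
  obtain ⟨i, rfl⟩ := hx
  exact hA.eigenvalues_pos i

theorem continuousOn_spectrum (f : ℝ → ℝ) : ContinuousOn f (spectrum ℝ A) :=
  (A.finite_real_spectrum).continuousOn f

theorem matLog_isHermitian (A : Matrix (Fin n) (Fin n) ℝ) : (matLog A).IsHermitian :=
  cfc_predicate Real.log A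

theorem matLog_exp (hA : A.IsHermitian) : matLog (NormedSpace.exp A) = A := by
  rw [← cfc_exp_eq_exp hA, matLog]
  refine (cfc_comp' Real.log Real.exp A
    ((A.finite_real_spectrum.image _).continuousOn _) (continuousOn_spectrum _) hA).symm.trans ?_
  simpa using cfc_id' ℝ A hA

theorem exp_matLog (hA : A.PosDef) : NormedSpace.exp (matLog A) = A := by
  rw [← cfc_exp_eq_exp (matLog_isHermitian A), matLog]
  refine (cfc_comp' Real.exp Real.log A
    ((A.finite_real_spectrum.image _).continuousOn _) (continuousOn_spectrum _) hA.1).symm.trans ?_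
  conv_rhs => rw [← cfc_id' ℝ A hA.1]
  exact cfc_congr fun x hx => Real.exp_log (spectrum_pos_of_posDef hA hx)

theorem exp_half_mul_exp_half (S : Matrix (Fin n) (Fin n) ℝ) :
    NormedSpace.exp ((2⁻¹ : ℝ) • S) * NormedSpace.exp ((2⁻¹ : ℝ) • S) = NormedSpace.exp S := by
  rw [← Matrix.exp_add_of_commute _ _ (Commute.refl _), ← add_smul]
  norm_num

theorem posDef_exp (hA : A.IsHermitian) : (NormedSpace.exp A).PosDef := by
  have h2 : ((2⁻¹ : ℝ) • A).IsHermitian := hA.smul (by simp [IsSelfAdjoint])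
  have h : NormedSpace.exp A =
      (NormedSpace.exp ((2⁻¹ : ℝ) • A))ᴴ * NormedSpace.exp ((2⁻¹ : ℝ) • A) := by
    rw [h2.exp.eq, exp_half_mul_exp_half]
  rw [h]
  exact Matrix.PosDef.conjTranspose_mul_self _
    (Matrix.mulVec_injective_of_isUnit (Matrix.isUnit_exp _))

theorem matSqrt_isHermitian (A : Matrix (Fin n) (Fin n) ℝ) : (matSqrt A).IsHermitian :=
  cfc_predicate Real.sqrt A

theorem matSqrt_mul_self (hA : A.PosDef) : matSqrt A * matSqrt A = A := by
  rw [matSqrt, ← cfc_mul _ _ A (continuousOn_spectrum _) (continuousOn_spectrum _)]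
  conv_rhs => rw [← cfc_id' ℝ A hA.1]
  exact cfc_congr fun x hx => Real.mul_self_sqrt (spectrum_pos_of_posDef hA hx).le

theorem isUnit_matSqrt (hA : A.PosDef) : IsUnit (matSqrt A) := by
  have h := hA.isUnit
  rw [← matSqrt_mul_self hA] at h
  exact isUnit_of_mul_isUnit_left h

theorem isUnit_inv_matSqrt (hA : A.PosDef) : IsUnit (matSqrt A)⁻¹ :=
  Matrix.isUnit_nonsing_inv_iff.2 (isUnit_matSqrt hA)

theorem inv_matSqrt_isHermitian (A : Matrix (Fin n) (Fin n) ℝ) : (matSqrt A)⁻¹.IsHermitian :=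
  (matSqrt_isHermitian A).inv

theorem posDef_conj_inv_matSqrt (hP : P.PosDef) (hQ : Q.PosDef) :
    ((matSqrt P)⁻¹ * Q * (matSqrt P)⁻¹).PosDef := by
  have h := hQ.conjTranspose_mul_mul_same
    (Matrix.mulVec_injective_of_isUnit (isUnit_inv_matSqrt hP))
  rwa [(inv_matSqrt_isHermitian P).eq] at h

/-- On the finite union of the two spectra, `f` agrees with an interpolation polynomial, and
polynomials intertwine. -/
theorem cfc_mul_eq_mul_cfc (f : ℝ → ℝ) (hA : A.IsHermitian) (hB : B.IsHermitian)
    (h : A * K = K * B) : cfc f A * K = K * cfc f B := by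
  classical
  let s := A.finite_real_spectrum.toFinset ∪ B.finite_real_spectrum.toFinset
  let p := Lagrange.interpolate s id f
  have hp (x : ℝ) (hx : x ∈ s) : f x = p.eval x :=
    (Lagrange.eval_interpolate_at_node f (fun _ _ _ _ h => h) hx).symm
  have hpA : cfc f A = Polynomial.aeval A p := by
    rw [← cfc_polynomial p A hA]
    exact cfc_congr fun x hx => hp x (Finset.mem_union_left _ (by simpa using hx))
  have hpB : cfc f B = Polynomial.aeval B p := by
    rw [← cfc_polynomial p B hB]
    exact cfc_congr fun x hx => hp x (Finset.mem_union_right _ (by simpa using hx))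
  rw [hpA, hpB]
  have hpow (k : ℕ) : A ^ k * K = K * B ^ k := by
    induction k with
    | zero => simp
    | succ k ih => rw [pow_succ, pow_succ, mul_assoc, h, ← mul_assoc, ih, mul_assoc]
  induction p using Polynomial.induction_on' with
  | add p q hp hq => rw [map_add, map_add, add_mul, mul_add, hp, hq]
  | monomial k a => simp [Polynomial.aeval_monomial, Algebra.algebraMap_eq_smul_one, hpow]

/-- Conjugating by `P^{1/2}`, the two forms of the Riemannian exponential at `P` agree. -/
theorem exp_inv_mul_conj (hP : P.PosDef) (L : Matrix (Fin n) (Fin n) ℝ) :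
    P * NormedSpace.exp (P⁻¹ * (matSqrt P * L * matSqrt P)) =
      matSqrt P * NormedSpace.exp L * matSqrt P := by
  have hu := isUnit_matSqrt hP
  have hd := (Matrix.isUnit_iff_isUnit_det _).1 hu
  have hPi : P⁻¹ = (matSqrt P)⁻¹ * (matSqrt P)⁻¹ := by
    conv_lhs => rw [← matSqrt_mul_self hP]
    rw [Matrix.mul_inv_rev]
  have h1 : P⁻¹ * (matSqrt P * L * matSqrt P) = (matSqrt P)⁻¹ * L * matSqrt P := by
    rw [hPi]
    simp only [mul_assoc]
    rw [Matrix.nonsing_inv_mul_cancel_left _ _ hd]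
  rw [h1, Matrix.exp_conj' _ _ hu]
  nth_rw 1 [← matSqrt_mul_self hP]
  simp only [mul_assoc]
  rw [Matrix.mul_nonsing_inv_cancel_left _ _ hd]

/-- `exp_P (log_P Q) = Q`, with the Riemannian exponential written as `V ↦ P exp (P⁻¹ V)`. -/
theorem mul_exp_inv_mul_log (hP : P.PosDef) (hQ : Q.PosDef) :
    P * NormedSpace.exp (P⁻¹ * (matSqrt P * relLog P Q * matSqrt P)) = Q := by
  have hd := (Matrix.isUnit_iff_isUnit_det _).1 (isUnit_matSqrt hP)
  rw [exp_inv_mul_conj hP, relLog, exp_matLog (posDef_conj_inv_matSqrt hP hQ)]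
  simp only [mul_assoc]
  rw [Matrix.mul_nonsing_inv_cancel_left _ _ hd, Matrix.nonsing_inv_mul _ hd, mul_one]

/-- Both sides are `-P⁻¹ log_P Q P⁻¹`: with `K = Q^{-1/2} P^{1/2}`, the matrix `K` intertwines
`K Kᵀ = Q^{-1/2} P Q^{-1/2}` and `Kᵀ K = (P^{-1/2} Q P^{-1/2})⁻¹`, hence also their logarithms. -/
theorem conj_inv_mul_relLog (hP : P.PosDef) (hQ : Q.PosDef) :
    (matSqrt Q)⁻¹ * (((matSqrt Q)⁻¹ * P * (matSqrt Q)⁻¹)⁻¹ * relLog Q P) * (matSqrt Q)⁻¹ =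
      -(P⁻¹ * (matSqrt P * relLog P Q * matSqrt P) * P⁻¹) := by
  have hPP := matSqrt_mul_self hP
  have hQQ := matSqrt_mul_self hQ
  have hpd := (Matrix.isUnit_iff_isUnit_det _).1 (isUnit_matSqrt hP)
  have hqd := (Matrix.isUnit_iff_isUnit_det _).1 (isUnit_matSqrt hQ)
  have hY := posDef_conj_inv_matSqrt hP hQ
  have hX := posDef_conj_inv_matSqrt hQ hP
  set p := matSqrt P with hp
  set q := matSqrt Q with hq
  have hpp : p * p⁻¹ = 1 := Matrix.mul_nonsing_inv _ hpd
  have hpp' : p⁻¹ * p = 1 := Matrix.nonsing_inv_mul _ hpd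
  have hqq : q * q⁻¹ = 1 := Matrix.mul_nonsing_inv _ hqd
  have hqq' : q⁻¹ * q = 1 := Matrix.nonsing_inv_mul _ hqd
  have hPi : P⁻¹ = p⁻¹ * p⁻¹ := by rw [← hPP, Matrix.mul_inv_rev]
  have hLneg : matLog (p * Q⁻¹ * p) = -relLog P Q := by
    have : p * Q⁻¹ * p = NormedSpace.exp (-relLog P Q) := by
      rw [Matrix.exp_neg, relLog, exp_matLog hY, Matrix.mul_inv_rev, Matrix.mul_inv_rev,
        Matrix.nonsing_inv_nonsing_inv _ hpd, mul_assoc]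
    rw [this]
    exact matLog_exp (matLog_isHermitian _).neg
  have hBh : (p * Q⁻¹ * p).IsHermitian := by
    have := Matrix.isHermitian_conjTranspose_mul_mul p hQ.1.inv
    rwa [(matSqrt_isHermitian P).eq] at this
  have hint : relLog Q P * (q⁻¹ * p) = (q⁻¹ * p) * (-relLog P Q) := by
    rw [← hLneg]
    refine cfc_mul_eq_mul_cfc Real.log hX.1 hBh ?_
    have hQi : Q⁻¹ = q⁻¹ * q⁻¹ := by rw [← hQQ, Matrix.mul_inv_rev]
    rw [hQi, ← hPP]
    simp only [← hq, mul_assoc]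
  have hXi : (q⁻¹ * P * q⁻¹)⁻¹ = q * P⁻¹ * q := by
    rw [Matrix.mul_inv_rev, Matrix.mul_inv_rev, Matrix.nonsing_inv_nonsing_inv _ hqd, mul_assoc]
  have h1 : relLog Q P * q⁻¹ = q⁻¹ * p * (-relLog P Q) * p⁻¹ := by
    rw [← hint]
    simp only [mul_assoc]
    rw [hpp, mul_one]
  have e1 : ∀ Z : Matrix (Fin n) (Fin n) ℝ, q * (q⁻¹ * Z) = Z := fun Z => by
    rw [← mul_assoc, hqq, one_mul]
  have e2 : ∀ Z : Matrix (Fin n) (Fin n) ℝ, q⁻¹ * (q * Z) = Z := fun Z => by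
    rw [← mul_assoc, hqq', one_mul]
  have e3 : ∀ Z : Matrix (Fin n) (Fin n) ℝ, p⁻¹ * (p * Z) = Z := fun Z => by
    rw [← mul_assoc, hpp', one_mul]
  have e4 : ∀ Z : Matrix (Fin n) (Fin n) ℝ, p * (p⁻¹ * Z) = Z := fun Z => by
    rw [← mul_assoc, hpp, one_mul]
  rw [hXi, hPi]
  simp only [mul_assoc]
  rw [h1]
  simp only [mul_assoc, e1, e2, e3, e4, neg_mul, mul_neg]

end MatrixAlgebra

/-! ### The derivative of the matrix exponential -/

section DerivExp

variable {n : ℕ} {S V C : Matrix (Fin n) (Fin n) ℝ}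

theorem contDiff_exp_matrix :
    ContDiff ℝ ∞ (NormedSpace.exp : Matrix (Fin n) (Fin n) ℝ → Matrix (Fin n) (Fin n) ℝ) :=
  contDiff_iff_contDiffAt.2 fun x => (NormedSpace.exp_analytic (𝕂 := ℝ) x).contDiffAt

/-- The derivative of the matrix exponential at `S`. -/
noncomputable def derivExp (S : Matrix (Fin n) (Fin n) ℝ) :
    Matrix (Fin n) (Fin n) ℝ →L[ℝ] Matrix (Fin n) (Fin n) ℝ :=
  fderiv ℝ NormedSpace.exp S

theorem hasFDerivAt_exp_matrix (S : Matrix (Fin n) (Fin n) ℝ) :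
    HasFDerivAt NormedSpace.exp (derivExp S) S :=
  (contDiff_exp_matrix.differentiable (by simp) S).hasFDerivAt

theorem continuous_derivExp : Continuous (derivExp (n := n)) :=
  contDiff_exp_matrix.continuous_fderiv (by simp)

theorem derivExp_apply_of_commute (h : Commute S V) :
    derivExp S V = NormedSpace.exp S * V := by
  have h1 : HasDerivAt (fun t : ℝ => NormedSpace.exp (S + t • V)) (derivExp S V) 0 := by
    have hl : HasDerivAt (fun t : ℝ => S + t • V) V 0 := by
      have := ((hasDerivAt_id (0 : ℝ)).smul_const V).const_add S
      rwa [one_smul] at this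
    have he : HasFDerivAt NormedSpace.exp (derivExp S) (S + (0 : ℝ) • V) := by
      simpa using hasFDerivAt_exp_matrix S
    exact he.comp_hasDerivAt 0 hl
  have h2 : HasDerivAt (fun t : ℝ => NormedSpace.exp (S + t • V)) (NormedSpace.exp S * V) 0 := by
    have h3 := (hasDerivAt_exp_smul_const (𝕂 := ℝ) V 0).const_mul (NormedSpace.exp S)
    simp only [zero_smul, NormedSpace.exp_zero, one_mul] at h3
    refine h3.congr_of_eventuallyEq (Filter.Eventually.of_forall fun t => ?_)
    exact Matrix.exp_add_of_commute _ _ (h.smul_right t)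
  exact h1.unique h2

/-- Differentiate `X exp X = exp X X`: a vector `V` in the kernel commutes with `exp S`, hence with
`S = log (exp S)`, and then the derivative in the direction `V` is `exp S * V`. -/
theorem derivExp_injective (hS : S.IsHermitian) : Function.Injective (derivExp S) := by
  rw [injective_iff_map_eq_zero]
  intro V hV
  have he := hasFDerivAt_exp_matrix S
  have h1 := (hasFDerivAt_id S).mul' he
  have h2 := he.mul' (hasFDerivAt_id S)
  have hfun : (id * NormedSpace.exp : Matrix (Fin n) (Fin n) ℝ → Matrix (Fin n) (Fin n) ℝ) =
      NormedSpace.exp * id := by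
    funext X
    exact ((Commute.refl X).exp_right).eq
  rw [hfun] at h1
  have h3 := congrArg (fun T => T V) (h1.unique h2)
  have h4 : S * derivExp S V + V * NormedSpace.exp S =
      NormedSpace.exp S * V + derivExp S V * S := h3
  have hc : Commute (NormedSpace.exp S) V := by
    rw [hV, mul_zero, zero_mul, zero_add, add_zero] at h4
    exact h4.symm
  have hcS : Commute S V := by
    have := cfc_mul_eq_mul_cfc Real.log (posDef_exp hS).1 (posDef_exp hS).1 hc.eq
    rw [← matLog, matLog_exp hS] at this
    exact this
  rw [derivExp_apply_of_commute hcS] at hV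
  have hd := (Matrix.isUnit_iff_isUnit_det _).1 (Matrix.isUnit_exp S)
  simpa [Matrix.nonsing_inv_mul_cancel_left _ _ hd] using
    congrArg (fun Z => (NormedSpace.exp S)⁻¹ * Z) hV

/-- Differentiate `exp X = exp (X / 2) * exp (X / 2)`; under the trace the two terms agree. -/
theorem trace_mul_derivExp_half (h : Commute C S) (V : Matrix (Fin n) (Fin n) ℝ) :
    (C * derivExp S V).trace =
      (C * NormedSpace.exp ((2⁻¹ : ℝ) • S) * derivExp ((2⁻¹ : ℝ) • S) V).trace := by
  set E := NormedSpace.exp ((2⁻¹ : ℝ) • S) with hE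
  have hCE : Commute C E := (h.smul_right _).exp_right
  have h1 : HasFDerivAt (fun X : Matrix (Fin n) (Fin n) ℝ => NormedSpace.exp ((2⁻¹ : ℝ) • X))
      ((derivExp ((2⁻¹ : ℝ) • S)).comp
        ((2⁻¹ : ℝ) • ContinuousLinearMap.id ℝ (Matrix (Fin n) (Fin n) ℝ))) S :=
    (hasFDerivAt_exp_matrix _).comp S ((hasFDerivAt_id S).const_smul (2⁻¹ : ℝ))
  have h2 := h1.mul' h1
  have hfun : ((fun X : Matrix (Fin n) (Fin n) ℝ => NormedSpace.exp ((2⁻¹ : ℝ) • X)) *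
      fun X => NormedSpace.exp ((2⁻¹ : ℝ) • X)) = NormedSpace.exp :=
    funext fun X => exp_half_mul_exp_half X
  rw [hfun] at h2
  have h3 := congrArg (fun T => T V) ((hasFDerivAt_exp_matrix S).unique h2)
  set W := derivExp ((2⁻¹ : ℝ) • S) V with hW
  have h4 : derivExp S V = (2⁻¹ : ℝ) • (E * W + W * E) := by
    have hS2 : derivExp ((2⁻¹ : ℝ) • S) ((2⁻¹ : ℝ) • V) = (2⁻¹ : ℝ) • W := map_smul _ _ _
    have h5 : derivExp S V = E * derivExp ((2⁻¹ : ℝ) • S) ((2⁻¹ : ℝ) • V) +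
      derivExp ((2⁻¹ : ℝ) • S) ((2⁻¹ : ℝ) • V) * E := h3
    rw [h5, hS2, Matrix.mul_smul, Matrix.smul_mul, smul_add]
  have h5 : (C * (W * E)).trace = (C * (E * W)).trace := by
    rw [← mul_assoc, Matrix.trace_mul_comm, ← mul_assoc, ← mul_assoc, hCE.eq]
  rw [h4, Matrix.mul_smul, Matrix.trace_smul, mul_add, Matrix.trace_add, h5, mul_assoc,
    smul_eq_mul]
  ring

/-- The quantity `Tr (C exp ((1 - s) S) derivExp (s S) V)` does not change when `s` is halved, and
tends to `Tr (C exp S V)` as `s → 0`. -/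
theorem trace_mul_derivExp (h : Commute C S) (V : Matrix (Fin n) (Fin n) ℝ) :
    (C * derivExp S V).trace = (C * NormedSpace.exp S * V).trace := by
  let u : ℝ → ℝ := fun s =>
    (C * NormedSpace.exp ((1 - s) • S) * derivExp (s • S) V).trace
  have hu : Continuous u := by
    have h1 : Continuous fun s : ℝ => NormedSpace.exp ((1 - s) • S) :=
      contDiff_exp_matrix.continuous.comp (by fun_prop)
    have h2 : Continuous fun s : ℝ => derivExp (s • S) V :=
      (continuous_derivExp.comp (by fun_prop)).clm_apply continuous_const
    exact ((continuous_const.mul h1).mul h2).matrix_trace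
  have hhalf (s : ℝ) : u s = u (2⁻¹ * s) := by
    have hc : Commute (C * NormedSpace.exp ((1 - s) • S)) (s • S) :=
      ((h.smul_right s)).mul_left
        ((((Commute.refl S).smul_right s).smul_left (1 - s)).exp_left)
    simp only [u]
    rw [trace_mul_derivExp_half hc V, mul_assoc C, ← Matrix.exp_add_of_commute _ _
      ((((Commute.refl S).smul_right s).smul_right _).smul_left _), smul_smul, ← add_smul]
    rw [show 1 - s + 2⁻¹ * s = 1 - 2⁻¹ * s by ring]
  have hpow (k : ℕ) : u (2⁻¹ ^ k) = u 1 := by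
    induction k with
    | zero => simp
    | succ k ih => rw [← ih, hhalf (2⁻¹ ^ k), pow_succ']
  have hlim : Filter.Tendsto (fun k : ℕ => u (2⁻¹ ^ k)) Filter.atTop (nhds (u 0)) :=
    (hu.tendsto 0).comp (tendsto_pow_atTop_nhds_zero_of_lt_one (by norm_num) (by norm_num))
  simp only [hpow] at hlim
  have h01 := tendsto_nhds_unique tendsto_const_nhds hlim
  have h0 : derivExp (0 : Matrix (Fin n) (Fin n) ℝ) V = V := by
    rw [derivExp_apply_of_commute (Commute.zero_left V), NormedSpace.exp_zero, one_mul]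
  simpa [u, h0] using h01

end DerivExp

/-! ### Smoothness of the logarithm and the derivative of `Tr ((log X)²)` -/

section SymmetricMatrices

variable {n : ℕ}

theorem isHermitian_coe (A : SymMat n) : (A : Matrix (Fin n) (Fin n) ℝ).IsHermitian := by
  rw [Matrix.IsHermitian, Matrix.conjTranspose_eq_transpose_of_trivial]
  exact A.2

/-- The projection `A ↦ (A + Aᵀ) / 2` onto the symmetric matrices. -/
noncomputable def symPart (n : ℕ) : Matrix (Fin n) (Fin n) ℝ →L[ℝ] SymMat n :=
  LinearMap.toContinuousLinearMap
    { toFun := fun A => ⟨(2⁻¹ : ℝ) • (A + Aᵀ), by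
        change ((2⁻¹ : ℝ) • (A + Aᵀ))ᵀ = (2⁻¹ : ℝ) • (A + Aᵀ)
        rw [Matrix.transpose_smul, Matrix.transpose_add, Matrix.transpose_transpose, add_comm]⟩
      map_add' := fun A B => Subtype.ext <| by
        change (2⁻¹ : ℝ) • (A + B + (A + B)ᵀ) = (2⁻¹ : ℝ) • (A + Aᵀ) + (2⁻¹ : ℝ) • (B + Bᵀ)
        rw [Matrix.transpose_add]
        module
      map_smul' := fun c A => Subtype.ext <| by
        change (2⁻¹ : ℝ) • (c • A + (c • A)ᵀ) = c • (2⁻¹ : ℝ) • (A + Aᵀ)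
        rw [Matrix.transpose_smul]
        module }

theorem symPart_coe (A : SymMat n) : symPart n (A : Matrix (Fin n) (Fin n) ℝ) = A := by
  apply Subtype.ext
  change (2⁻¹ : ℝ) • ((A : Matrix (Fin n) (Fin n) ℝ) + (A : Matrix (Fin n) (Fin n) ℝ)ᵀ) = A
  rw [show (A : Matrix (Fin n) (Fin n) ℝ)ᵀ = A from A.2]
  module

theorem symPart_of_isHermitian {A : Matrix (Fin n) (Fin n) ℝ} (hA : A.IsHermitian) :
    (symPart n A : Matrix (Fin n) (Fin n) ℝ) = A :=
  congrArg Subtype.val (symPart_coe ⟨A, hA⟩)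

/-- The exponential as a map of `Sym(n)` to itself. -/
noncomputable def expSym (S : SymMat n) : SymMat n := symPart n (NormedSpace.exp S.1)

theorem coe_expSym (S : SymMat n) :
    (expSym S : Matrix (Fin n) (Fin n) ℝ) = NormedSpace.exp S.1 :=
  symPart_of_isHermitian (isHermitian_coe S).exp

theorem contDiff_expSym : ContDiff ℝ ∞ (expSym (n := n)) :=
  (symPart n).contDiff.comp (contDiff_exp_matrix.comp (SymMat n).subtypeL.contDiff)

/-- The logarithm as a map of `Sym(n)` to itself. -/
noncomputable def logSym (X : SymMat n) : SymMat n := ⟨matLog X.1, matLog_isHermitian X.1⟩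

theorem logSym_expSym (S : SymMat n) : logSym (expSym S) = S :=
  Subtype.ext <| (congrArg matLog (coe_expSym S)).trans (matLog_exp (isHermitian_coe S))

theorem expSym_logSym {X : SymMat n} (hX : X ∈ SPD n) : expSym (logSym X) = X :=
  Subtype.ext <| (coe_expSym _).trans (exp_matLog hX)

theorem expSym_mem_SPD (S : SymMat n) : expSym S ∈ SPD n := by
  change (expSym S : Matrix (Fin n) (Fin n) ℝ).PosDef
  rw [coe_expSym]
  exact posDef_exp (isHermitian_coe S)

theorem exists_equiv_hasFDerivAt_expSym (S : SymMat n) :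
    ∃ D : SymMat n ≃L[ℝ] SymMat n, HasFDerivAt expSym (D : SymMat n →L[ℝ] SymMat n) S ∧
      ∀ V : SymMat n, (D V : Matrix (Fin n) (Fin n) ℝ) = derivExp S.1 V := by
  have h1 : HasFDerivAt expSym (fderiv ℝ expSym S) S :=
    (contDiff_expSym.differentiable (by simp) S).hasFDerivAt
  have h2 : HasFDerivAt (fun X : SymMat n => (expSym X : Matrix (Fin n) (Fin n) ℝ))
      ((SymMat n).subtypeL.comp (fderiv ℝ expSym S)) S :=
    (SymMat n).subtypeL.hasFDerivAt.comp S h1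
  have h3 : HasFDerivAt (fun X : SymMat n => (expSym X : Matrix (Fin n) (Fin n) ℝ))
      ((derivExp S.1).comp (SymMat n).subtypeL) S := by
    simp only [coe_expSym]
    exact (hasFDerivAt_exp_matrix S.1).comp S (SymMat n).subtypeL.hasFDerivAt
  have h4 (V : SymMat n) : (fderiv ℝ expSym S V : Matrix (Fin n) (Fin n) ℝ) = derivExp S.1 V :=
    congrArg (fun T => T V) (h2.unique h3)
  have hinj : Function.Injective (fderiv ℝ expSym S).toLinearMap := fun V W h =>
    Subtype.ext <| derivExp_injective (isHermitian_coe S) <| by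
      rw [← h4, ← h4]
      exact congrArg Subtype.val h
  refine ⟨(LinearEquiv.ofInjectiveEndo _ hinj).toContinuousLinearEquiv, ?_, h4⟩
  have h5 : ((LinearEquiv.ofInjectiveEndo _ hinj).toContinuousLinearEquiv :
      SymMat n →L[ℝ] SymMat n) = fderiv ℝ expSym S := rfl
  rw [h5]
  exact h1

/-- Near a positive definite matrix, `log` is the inverse of the local diffeomorphism `exp`. -/
theorem contDiffAt_logSym_and_SPD_mem_nhds {X : SymMat n} (hX : X ∈ SPD n) :
    ContDiffAt ℝ ∞ logSym X ∧ SPD n ∈ nhds X := by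
  obtain ⟨D, hD, -⟩ := exists_equiv_hasFDerivAt_expSym (logSym X)
  have hc : ContDiffAt ℝ ∞ expSym (logSym X) := contDiff_expSym.contDiffAt
  have hloc := hc.to_localInverse hD (by simp)
  have hev := (hc.hasStrictFDerivAt' hD (by simp)).eventually_right_inverse
  rw [expSym_logSym hX] at hloc hev
  constructor
  · refine hloc.congr_of_eventuallyEq ?_
    filter_upwards [hev] with Y hY
    conv_lhs => rw [← hY]
    exact logSym_expSym _
  · filter_upwards [hev] with Y hY
    rw [← hY]
    exact expSym_mem_SPD _

theorem isOpen_SPD : IsOpen (SPD n) :=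
  isOpen_iff_mem_nhds.2 fun _ hX => (contDiffAt_logSym_and_SPD_mem_nhds hX).2

/-- `X ↦ Tr ((log X)²)`. -/
noncomputable def traceSqLog (X : SymMat n) : ℝ := (matLog X.1 * matLog X.1).trace

theorem contDiffAt_traceSqLog {X : SymMat n} (hX : X ∈ SPD n) : ContDiffAt ℝ ∞ traceSqLog X := by
  have h1 : ContDiffAt ℝ ∞ (fun Y : SymMat n => (logSym Y : Matrix (Fin n) (Fin n) ℝ)) X :=
    (SymMat n).subtypeL.contDiff.contDiffAt.comp X (contDiffAt_logSym_and_SPD_mem_nhds hX).1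
  exact (LinearMap.toContinuousLinearMap
    (Matrix.traceLinearMap (Fin n) ℝ ℝ)).contDiff.contDiffAt.comp X (h1.mul h1)

/-- Differentiate `traceSqLog (exp S) = Tr (S²)` and use `trace_mul_derivExp` with
`C = exp (-S) S`. -/
theorem fderiv_traceSqLog {X : SymMat n} (hX : X ∈ SPD n) (W : SymMat n) :
    fderiv ℝ traceSqLog X W = 2 * (X.1⁻¹ * matLog X.1 * W.1).trace := by
  set S := logSym X with hS
  have hXS : expSym S = X := expSym_logSym hX
  obtain ⟨D, hD, hDV⟩ := exists_equiv_hasFDerivAt_expSym S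
  obtain ⟨V, rfl⟩ := D.surjective W
  have h1 : HasFDerivAt traceSqLog (fderiv ℝ traceSqLog X) (expSym S) := by
    rw [hXS]
    exact ((contDiffAt_traceSqLog hX).differentiableAt (by simp)).hasFDerivAt
  have h2 := h1.comp S hD
  have hfun : traceSqLog ∘ expSym = fun T : SymMat n => (T.1 * T.1).trace := by
    funext T
    have : matLog (expSym T).1 = T.1 := congrArg Subtype.val (logSym_expSym T)
    simp only [Function.comp, traceSqLog, this]
  rw [hfun] at h2
  have hsub : HasFDerivAt (fun T : SymMat n => T.1) (SymMat n).subtypeL S :=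
    (SymMat n).subtypeL.hasFDerivAt
  have h3 := (LinearMap.toContinuousLinearMap
    (Matrix.traceLinearMap (Fin n) ℝ ℝ)).hasFDerivAt.comp S (hsub.mul' hsub)
  have h4 : fderiv ℝ traceSqLog X (D V) = (S.1 * V.1 + V.1 * S.1).trace :=
    congrArg (fun T => T V) (h2.unique h3)
  have hX1 : X.1 = NormedSpace.exp S.1 := by rw [← hXS, coe_expSym]
  have hd := (Matrix.isUnit_iff_isUnit_det _).1 (Matrix.isUnit_exp S.1)
  have hcomm : Commute (NormedSpace.exp (-S.1)) S.1 := ((Commute.refl S.1).neg_left).exp_left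
  have hlog : matLog X.1 = S.1 := rfl
  rw [h4, hDV, hlog, hX1, ← Matrix.exp_neg,
    trace_mul_derivExp (hcomm.mul_left (Commute.refl _)), hcomm.eq, mul_assoc S.1,
    ← Matrix.exp_add_of_commute _ _ ((Commute.refl S.1).neg_left), neg_add_cancel,
    NormedSpace.exp_zero, mul_one, Matrix.trace_add, Matrix.trace_mul_comm V.1, two_mul]

end SymmetricMatrices

/-! ### The differential of the squared Fréchet map -/

section FrechetMap

variable {n ℓ : ℕ}

/-- The congruence `A ↦ M A Mᵀ` of `Sym(n)`. -/
noncomputable def congruence (M : Matrix (Fin n) (Fin n) ℝ) : SymMat n →L[ℝ] SymMat n :=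
  LinearMap.toContinuousLinearMap
    { toFun := fun A => ⟨M * A.1 * Mᵀ, by
        change (M * A.1 * Mᵀ)ᵀ = M * A.1 * Mᵀ
        rw [Matrix.transpose_mul, Matrix.transpose_mul, Matrix.transpose_transpose,
          show A.1ᵀ = A.1 from A.2, mul_assoc]⟩
      map_add' := fun A B => Subtype.ext <| by
        change M * (A.1 + B.1) * Mᵀ = M * A.1 * Mᵀ + M * B.1 * Mᵀ
        rw [mul_add, add_mul]
      map_smul' := fun c A => Subtype.ext <| by
        change M * (c • A.1) * Mᵀ = c • (M * A.1 * Mᵀ)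
        rw [Matrix.mul_smul, Matrix.smul_mul] }

theorem coe_congruence_inv_matSqrt (R A : SymMat n) :
    (congruence (matSqrt R.1)⁻¹ A).1 = (matSqrt R.1)⁻¹ * A.1 * (matSqrt R.1)⁻¹ := by
  change _ * _ * ((matSqrt R.1)⁻¹)ᵀ = _
  rw [← Matrix.conjTranspose_eq_transpose_of_trivial, (inv_matSqrt_isHermitian R.1).eq]

theorem spdDist_sq (R P : SymMat n) :
    spdDist R P ^ 2 = traceSqLog (congruence (matSqrt R.1)⁻¹ P) := by
  have h : traceSqLog (congruence (matSqrt R.1)⁻¹ P) = (relLog R.1 P.1 ^ 2).trace := by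
    rw [traceSqLog, coe_congruence_inv_matSqrt, sq, relLog]
  rw [h, spdDist, Real.sq_sqrt]
  have h2 := (Matrix.posSemidef_conjTranspose_mul_self (relLog R.1 P.1)).trace_nonneg
  have h3 : (relLog R.1 P.1)ᴴ = relLog R.1 P.1 := (matLog_isHermitian _).eq
  rwa [h3, ← sq] at h2

theorem congruence_inv_matSqrt_mem_SPD {R P : SymMat n} (hR : R ∈ SPD n) (hP : P ∈ SPD n) :
    congruence (matSqrt R.1)⁻¹ P ∈ SPD n := by
  change (congruence (matSqrt R.1)⁻¹ P).1.PosDef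
  rw [coe_congruence_inv_matSqrt]
  exact posDef_conj_inv_matSqrt hR hP

theorem contDiffAt_spdDist_sq {R P : SymMat n} (hR : R ∈ SPD n) (hP : P ∈ SPD n) :
    ContDiffAt ℝ ∞ (fun P => spdDist R P ^ 2) P := by
  simp only [spdDist_sq]
  exact (contDiffAt_traceSqLog (congruence_inv_matSqrt_mem_SPD hR hP)).comp P
    (congruence (matSqrt R.1)⁻¹).contDiff.contDiffAt

/-- The Riemannian gradient of `d(R, ·)²` at `P` is `-2 log_P R`. -/
theorem fderiv_spdDist_sq {R P : SymMat n} (hR : R ∈ SPD n) (hP : P ∈ SPD n) (V : SymMat n) :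
    fderiv ℝ (fun P => spdDist R P ^ 2) P V =
      -2 * (P.1⁻¹ * (logMap P R).1 * P.1⁻¹ * V.1).trace := by
  have hX := congruence_inv_matSqrt_mem_SPD hR hP
  simp only [spdDist_sq]
  have h1 := ((contDiffAt_traceSqLog hX).differentiableAt (by simp)).hasFDerivAt.comp P
    (congruence (matSqrt R.1)⁻¹).hasFDerivAt
  have h2 : fderiv ℝ (fun P => traceSqLog (congruence (matSqrt R.1)⁻¹ P)) P V =
      fderiv ℝ traceSqLog (congruence (matSqrt R.1)⁻¹ P) (congruence (matSqrt R.1)⁻¹ V) :=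
    congrArg (fun T => T V) h1.fderiv
  have h3 := conj_inv_mul_relLog (P := P.1) (Q := R.1) hP hR
  rw [h2, fderiv_traceSqLog hX, coe_congruence_inv_matSqrt, coe_congruence_inv_matSqrt, ← relLog,
    ← mul_assoc, Matrix.trace_mul_comm, ← mul_assoc, ← mul_assoc, h3]
  change 2 * (-(P.1⁻¹ * (logMap P R).1 * P.1⁻¹) * V.1).trace = _
  rw [neg_mul, Matrix.trace_neg]
  ring

theorem contDiffAt_frechetMap {R : Fin ℓ → SymMat n} (hR : ∀ i, R i ∈ SPD n) {P : SymMat n}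
    (hP : P ∈ SPD n) : ContDiffAt ℝ ∞ (frechetMap R) P :=
  contDiffAt_pi.2 fun i => contDiffAt_spdDist_sq (hR i) hP

theorem fderiv_frechetMap_apply {R : Fin ℓ → SymMat n} (hR : ∀ i, R i ∈ SPD n) {P : SymMat n}
    (hP : P ∈ SPD n) (V : SymMat n) (i : Fin ℓ) :
    fderiv ℝ (frechetMap R) P V i =
      -2 * (P.1⁻¹ * (logMap P (R i)).1 * P.1⁻¹ * V.1).trace := by
  rw [← fderiv_spdDist_sq (hR i) hP]
  have h := hasFDerivAt_pi'.1
    ((contDiffAt_frechetMap hR hP).differentiableAt (by simp)).hasFDerivAt i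
  exact (congrArg (fun T => T V) h.fderiv).symm

/-- If `V` is in the kernel then `Tr (P⁻¹ W P⁻¹ V) = 0` for all `W` in the span of the
`log_P R_i`, in particular for `W = V`, and `Tr (P⁻¹ V P⁻¹ V)` is the squared length of `V`. -/
theorem fderiv_frechetMap_injective {R : Fin ℓ → SymMat n} (hR : ∀ i, R i ∈ SPD n) {P : SymMat n}
    (hP : P ∈ SPD n)
    (hspan : Submodule.span ℝ (Set.range fun i => logMap P (R i)) = ⊤) :
    Function.Injective (fderiv ℝ (frechetMap R) P) := by
  rw [injective_iff_map_eq_zero]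
  intro V hV
  have h1 (W : SymMat n) : (P.1⁻¹ * W.1 * P.1⁻¹ * V.1).trace = 0 := by
    have hW : W ∈ Submodule.span ℝ (Set.range fun i => logMap P (R i)) := hspan ▸ Submodule.mem_top
    induction hW using Submodule.span_induction with
    | mem W h =>
      obtain ⟨i, rfl⟩ := h
      have := fderiv_frechetMap_apply hR hP V i
      rw [hV] at this
      simpa using this.symm
    | zero => simp
    | add W W' _ _ h h' =>
      rw [Submodule.coe_add, mul_add, add_mul, add_mul, Matrix.trace_add, h, h', add_zero]
    | smul c W _ h =>
      rw [Submodule.coe_smul, Matrix.mul_smul, Matrix.smul_mul, Matrix.smul_mul,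
        Matrix.trace_smul, h, smul_zero]
  have hPd : (P.1).PosDef := hP
  have hqu := isUnit_inv_matSqrt hPd
  have hqh := inv_matSqrt_isHermitian P.1
  have hPi : P.1⁻¹ = (matSqrt P.1)⁻¹ * (matSqrt P.1)⁻¹ := by
    conv_lhs => rw [← matSqrt_mul_self hPd]
    rw [Matrix.mul_inv_rev]
  set q := (matSqrt P.1)⁻¹
  have h2 : ((q * V.1 * q)ᴴ * (q * V.1 * q)).trace = 0 := by
    rw [Matrix.conjTranspose_mul, Matrix.conjTranspose_mul, hqh.eq,
      (isHermitian_coe V).eq, ← h1 V, hPi]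
    rw [show q * (V.1 * q) * (q * V.1 * q) = (q * V.1 * (q * q) * V.1) * q by
      simp only [mul_assoc], Matrix.trace_mul_comm]
    simp only [mul_assoc]
  rw [Matrix.trace_conjTranspose_mul_self_eq_zero_iff] at h2
  apply Subtype.ext
  have h3 := hqu.mul_left_eq_zero.1 h2
  exact hqu.mul_right_eq_zero.1 h3

end FrechetMap

/-! ### Local inversion of immersions -/

section Immersion

/-- The immersion theorem. Compose `F` with a left inverse `L` of its derivative: the inverse
function theorem applies to `L ∘ F`, and `(L ∘ F)⁻¹ ∘ L` inverts `F` locally. -/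
theorem isLocalDiffeoOntoImageAt_of_injective_fderiv {E G : Type*} [NormedAddCommGroup E]
    [NormedSpace ℝ E] [FiniteDimensional ℝ E] [NormedAddCommGroup G] [NormedSpace ℝ G]
    [FiniteDimensional ℝ G] {F : E → G} {Ω : Set E} (hΩ : IsOpen Ω) (hF : ContDiffOn ℝ ∞ F Ω)
    {x : E} (hx : x ∈ Ω) (hinj : Function.Injective (fderiv ℝ F x)) :
    IsLocalDiffeoOntoImageAt F Ω x := by
  have : CompleteSpace E := FiniteDimensional.complete ℝ E
  obtain ⟨L₀, hL₀⟩ := LinearMap.exists_leftInverse_of_injective (fderiv ℝ F x).toLinearMap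
    (LinearMap.ker_eq_bot.2 hinj)
  let L : G →L[ℝ] E := LinearMap.toContinuousLinearMap L₀
  have hL : L.comp (fderiv ℝ F x) = ContinuousLinearMap.id ℝ E :=
    ContinuousLinearMap.ext fun v => congrArg (fun T => T v) hL₀
  have hFx : ContDiffAt ℝ ∞ F x := hF.contDiffAt (hΩ.mem_nhds hx)
  let h : E → E := L ∘ F
  have hh : ContDiffOn ℝ ∞ h Ω := L.contDiff.comp_contDiffOn hF
  have hhx : ContDiffAt ℝ ∞ h x := hh.contDiffAt (hΩ.mem_nhds hx)
  have hd : HasFDerivAt h ((ContinuousLinearEquiv.refl ℝ E : E ≃L[ℝ] E) : E →L[ℝ] E) x := by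
    have h1 := L.hasFDerivAt.comp x (hFx.differentiableAt (by simp)).hasFDerivAt
    rw [hL] at h1
    exact h1
  let Φ := hhx.toOpenPartialHomeomorph h hd (by simp)
  have hΦ : (Φ : E → E) = h := rfl
  -- `ContDiffAt ℝ ∞` of the inverse at one point does not give a neighbourhood of smoothness, hence
  -- the restriction to the open set where the derivative of `h` is invertible.
  let W : Set E := Ω ∩ fderiv ℝ h ⁻¹' Set.range ((↑) : (E ≃L[ℝ] E) → E →L[ℝ] E)
  have hW : IsOpen W := (hh.continuousOn_fderiv_of_isOpen hΩ (by simp)).isOpen_inter_preimage hΩ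
    ContinuousLinearEquiv.isOpen
  refine ⟨Φ.source ∩ W, Φ.open_source.inter hW,
    ⟨hhx.mem_toOpenPartialHomeomorph_source hd (by simp), hx, ⟨_, hd.fderiv.symm⟩⟩,
    fun y hy => hy.2.1, hF.mono fun y hy => hy.2.1,
    L ⁻¹' (Φ.target ∩ Φ.symm ⁻¹' W), Φ.symm ∘ L,
    (Φ.isOpen_inter_preimage_symm hW).preimage L.continuous, ?_, ?_, ?_⟩
  · rintro _ ⟨y, hy, rfl⟩
    have h1 : Φ.symm (L (F y)) = y := Φ.left_inv hy.1
    refine ⟨Φ.map_source hy.1, ?_⟩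
    change Φ.symm (L (F y)) ∈ W
    rw [h1]
    exact hy.2
  · rintro z ⟨hz, hzΩ, ⟨D, hD⟩⟩
    have h1 : ContDiffAt ℝ ∞ h (Φ.symm (L z)) := hh.contDiffAt (hΩ.mem_nhds hzΩ)
    have h2 : HasFDerivAt Φ (D : E →L[ℝ] E) (Φ.symm (L z)) := by
      rw [hD]
      exact (h1.differentiableAt (by simp)).hasFDerivAt
    exact ((Φ.contDiffAt_symm hz h2 h1).comp z L.contDiff.contDiffAt).contDiffWithinAt
  · exact fun y hy => Φ.left_inv hy.1

end Immersion

/-! ### Lebesgue measure on `Sym(n)` and images of spaces of smaller dimension -/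

section LebesgueMeasure

/-- The linear coordinates of `Sym(n)` given by the entries. -/
noncomputable def entriesEquiv (n : ℕ) : (Sym2 (Fin n) → ℝ) ≃L[ℝ] SymMat n :=
  LinearEquiv.toContinuousLinearEquiv
    { toFun := symOfEntries n
      map_add' := fun _ _ => rfl
      map_smul' := fun _ _ => rfl
      invFun := fun A => Sym2.lift ⟨fun i j => A.1 i j, fun i j => (A.2.apply i j).symm⟩
      left_inv := fun v => funext fun z => by
        induction z using Sym2.ind with
        | _ i j => rfl
      right_inv := fun _ => rfl }

theorem finrank_symMat (n : ℕ) : Module.finrank ℝ (SymMat n) = n * (n + 1) / 2 := by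
  rw [← (entriesEquiv n).toLinearEquiv.finrank_eq, Module.finrank_pi, Sym2.card, Fintype.card_fin,
    Nat.choose_two_right, Nat.add_sub_cancel, mul_comm]

instance isAddHaarMeasure_lebesgueSym (n : ℕ) : (lebesgueSym n).IsAddHaarMeasure :=
  (entriesEquiv n).isAddHaarMeasure_map volume

instance secondCountableTopology_symMat (n : ℕ) : SecondCountableTopology (SymMat n) :=
  (entriesEquiv n).symm.toHomeomorph.secondCountableTopology

instance sigmaCompactSpace_symMat (n : ℕ) : SigmaCompactSpace (SymMat n) :=
  (entriesEquiv n).symm.toHomeomorph.isClosedEmbedding.sigmaCompactSpace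

/-- Precomposing with a linear surjection `E → D`, which is not injective, gives a map `E → E` whose
derivative is nowhere invertible on the relevant set. -/
theorem addHaar_image_eq_zero_of_finrank_lt {D E : Type*} [NormedAddCommGroup D]
    [NormedSpace ℝ D] [FiniteDimensional ℝ D] [NormedAddCommGroup E] [NormedSpace ℝ E]
    [FiniteDimensional ℝ E] [MeasurableSpace E] [BorelSpace E] (μ : Measure E)
    [μ.IsAddHaarMeasure] (hlt : Module.finrank ℝ D < Module.finrank ℝ E) {f : D → E} {s : Set D}
    (hf : ∀ x ∈ s, DifferentiableAt ℝ f x) : μ (f '' s) = 0 := by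
  let p : E →ₗ[ℝ] D := (Module.finBasis ℝ D).equivFun.symm.toLinearMap ∘ₗ
    LinearMap.funLeft ℝ ℝ (Fin.castLE hlt.le) ∘ₗ (Module.finBasis ℝ E).equivFun.toLinearMap
  have hp : Function.Surjective p := (Module.finBasis ℝ D).equivFun.symm.surjective.comp
    ((LinearMap.funLeft_surjective_of_injective ℝ ℝ _ (Fin.castLE_injective hlt.le)).comp
      (Module.finBasis ℝ E).equivFun.surjective)
  let q : E →L[ℝ] D := LinearMap.toContinuousLinearMap p
  have himage : f '' s = (f ∘ q) '' (q ⁻¹' s) := by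
    rw [Set.image_comp, Set.image_preimage_eq s (show Function.Surjective q from hp)]
  rw [himage]
  refine addHaar_image_eq_zero_of_det_fderivWithin_eq_zero μ
    (f' := fun x => (fderiv ℝ f (q x)).comp q)
    (fun x hx => ((hf _ hx).hasFDerivAt.comp x q.hasFDerivAt).hasFDerivWithinAt) fun x _ => ?_
  obtain ⟨v, hv, hv0⟩ := (Submodule.ne_bot_iff _).1
    (LinearMap.ker_ne_bot_of_finrank_lt (f := p) hlt)
  refine LinearMap.det_eq_zero_iff_ker_ne_bot.2 ((Submodule.ne_bot_iff _).2 ⟨v, ?_, hv0⟩)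
  change fderiv ℝ f (q x) (p v) = 0
  rw [LinearMap.mem_ker.1 hv, map_zero]

end LebesgueMeasure

/-! ### Configurations with a rank-deficient point form a null set -/

section DegenerateConfigurations

variable {n ℓ : ℕ}

/-- The point of the hyperplane `v_k = ∑ c_j v_j` with coordinates `w_j`, `j ≠ k`. -/
noncomputable def hyperplanePoint {ι : Type*} [Fintype ι] [DecidableEq ι] (k : ι)
    (c w : {j // j ≠ k} → ℝ) : ι → ℝ :=
  fun j => if h : j = k then ∑ i, c i * w i else w ⟨j, h⟩

/-- Every proper subspace of `ι → ℝ` lies in one of the hyperplanes `v_k = ∑ c_j v_j`. -/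
theorem exists_hyperplanePoint_of_ne_top {ι : Type*} [Fintype ι] [DecidableEq ι]
    {p : Submodule ℝ (ι → ℝ)} (hp : p ≠ ⊤) :
    ∃ (k : ι) (c : {j // j ≠ k} → ℝ), ∀ v ∈ p, hyperplanePoint k c (fun j => v j) = v := by
  obtain ⟨f, hf, hpf⟩ := p.exists_le_ker_of_lt_top hp.lt_top
  have hfv (v : ι → ℝ) : f v = ∑ j, v j * f (Pi.single j 1) := by
    rw [LinearMap.pi_apply_eq_sum_univ f v]
    simp only [smul_eq_mul]
    refine Finset.sum_congr rfl fun j _ => ?_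
    congr 2
    ext i
    simp [Pi.single_apply, eq_comm]
  obtain ⟨k, hk⟩ : ∃ k, f (Pi.single k 1) ≠ 0 := by
    by_contra! h
    exact hf (LinearMap.ext fun v => by rw [hfv]; simp [h])
  refine ⟨k, fun j => -f (Pi.single j.1 1) / f (Pi.single k 1), fun v hv => ?_⟩
  funext j
  unfold hyperplanePoint
  split_ifs with h
  · subst h
    have h0 : f v = 0 := hpf hv
    rw [hfv, Fintype.sum_eq_add_sum_subtype_ne _ j] at h0
    have h1 : ∑ i : {i // i ≠ j}, -f (Pi.single i.1 1) / f (Pi.single j 1) * v i =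
        -(∑ i : {i // i ≠ j}, v i * f (Pi.single i.1 1)) / f (Pi.single j 1) := by
      rw [← Finset.sum_neg_distrib, Finset.sum_div]
      exact Finset.sum_congr rfl fun i _ => by ring
    rw [h1, div_eq_iff hk]
    linarith
  · rfl

/-- The family `(exp_P v_i)` for vectors `v_i` in the hyperplane `v_k = ∑ c_j v_j` of `Sym(n)`,
as a function of the base point `P`, the coefficients `c` and the free coordinates of the `v_i`.
Here `exp_P V = P exp (P⁻¹ V)`. -/
noncomputable def degenerateFamily (ℓ : ℕ) (k : Sym2 (Fin n))
    (x : SymMat n × ({j // j ≠ k} → ℝ) × (Fin ℓ → {j // j ≠ k} → ℝ)) : Fin ℓ → SymMat n :=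
  fun i => symPart n (x.1.1 * NormedSpace.exp
    (x.1.1⁻¹ * (entriesEquiv n (hyperplanePoint k x.2.1 (x.2.2 i))).1))

theorem differentiable_hyperplanePoint {ι : Type*} [Fintype ι] [DecidableEq ι] (k : ι) :
    Differentiable ℝ fun x : ({j // j ≠ k} → ℝ) × ({j // j ≠ k} → ℝ) =>
      hyperplanePoint k x.1 x.2 := by
  refine differentiable_pi.2 fun j => ?_
  unfold hyperplanePoint
  split_ifs with h
  · fun_prop
  · fun_prop

theorem differentiableAt_degenerateFamily (k : Sym2 (Fin n))
    {x : SymMat n × ({j // j ≠ k} → ℝ) × (Fin ℓ → {j // j ≠ k} → ℝ)} (hx : x.1 ∈ SPD n) :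
    DifferentiableAt ℝ (degenerateFamily ℓ k) x := by
  refine differentiableAt_pi.2 fun i => ?_
  have h1 : DifferentiableAt ℝ (fun x : SymMat n × ({j // j ≠ k} → ℝ) ×
      (Fin ℓ → {j // j ≠ k} → ℝ) => x.1.1) x :=
    (SymMat n).subtypeL.differentiableAt.comp x differentiableAt_fst
  have h2 : DifferentiableAt ℝ (fun x : SymMat n × ({j // j ≠ k} → ℝ) ×
      (Fin ℓ → {j // j ≠ k} → ℝ) => x.1.1⁻¹) x := by
    simp only [Matrix.nonsing_inv_eq_ringInverse]
    have hu : IsUnit x.1.1 := Matrix.PosDef.isUnit hx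
    obtain ⟨u, hu⟩ := hu
    have h3 := (contDiffAt_ringInverse (n := 1) ℝ u).differentiableAt (by simp)
    rw [hu] at h3
    exact h3.comp x h1
  have h4 : DifferentiableAt ℝ (fun x : SymMat n × ({j // j ≠ k} → ℝ) ×
      (Fin ℓ → {j // j ≠ k} → ℝ) =>
        (entriesEquiv n (hyperplanePoint k x.2.1 (x.2.2 i))).1) x := by
    have h5 : DifferentiableAt ℝ (fun x : SymMat n × ({j // j ≠ k} → ℝ) ×
        (Fin ℓ → {j // j ≠ k} → ℝ) => (x.2.1, x.2.2 i)) x := by fun_prop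
    have h6 := (differentiable_hyperplanePoint k (x.2.1, x.2.2 i)).comp x h5
    exact ((SymMat n).subtypeL.comp (entriesEquiv n : (Sym2 (Fin n) → ℝ) →L[ℝ] SymMat n)
      ).differentiableAt.comp x h6
  have h7 : DifferentiableAt ℝ (NormedSpace.exp : Matrix (Fin n) (Fin n) ℝ → _)
      (x.1.1⁻¹ * (entriesEquiv n (hyperplanePoint k x.2.1 (x.2.2 i))).1) :=
    contDiff_exp_matrix.differentiable (by simp) _
  exact (symPart n).differentiableAt.comp x (h1.mul (h7.comp x (h2.mul h4)))

/-- The parameter count: with `m = n (n + 1) / 2`, the domain has dimension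
`m + (m - 1) + ℓ (m - 1) = ℓ m + (2 m - 1 - ℓ) < ℓ m`. -/
theorem finrank_degenerateFamily_domain_lt (hℓ : 2 * (n * (n + 1) / 2) ≤ ℓ) (k : Sym2 (Fin n)) :
    Module.finrank ℝ (SymMat n × ({j // j ≠ k} → ℝ) × (Fin ℓ → {j // j ≠ k} → ℝ)) <
      Module.finrank ℝ (Fin ℓ → SymMat n) := by
  have hm : Fintype.card (Sym2 (Fin n)) = n * (n + 1) / 2 := by
    rw [← finrank_symMat, ← (entriesEquiv n).toLinearEquiv.finrank_eq, Module.finrank_pi]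
  have hpos : 0 < Fintype.card (Sym2 (Fin n)) := Fintype.card_pos_iff.2 ⟨k⟩
  have hne : Module.finrank ℝ ({j // j ≠ k} → ℝ) = n * (n + 1) / 2 - 1 := by
    rw [Module.finrank_pi, Fintype.card_subtype_compl, Fintype.card_subtype_eq, hm]
  have hpi {V : Type} [NormedAddCommGroup V] [NormedSpace ℝ V] [FiniteDimensional ℝ V] :
      Module.finrank ℝ (Fin ℓ → V) = ℓ * Module.finrank ℝ V := by
    rw [Module.finrank_pi_fintype, Finset.sum_const, Finset.card_univ, Fintype.card_fin,
      smul_eq_mul]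
  rw [Module.finrank_prod, Module.finrank_prod, hpi, hpi, hne, finrank_symMat]
  rw [hm] at hpos
  obtain ⟨m, hm'⟩ := Nat.exists_eq_add_of_lt hpos
  rw [hm'] at hℓ ⊢
  simp only [zero_add, Nat.add_sub_cancel] at hℓ ⊢
  rw [mul_add]
  omega

theorem mem_degenerateFamily_image_of_span_ne_top {R : Fin ℓ → SymMat n}
    (hR : ∀ i, R i ∈ SPD n) {P : SymMat n} (hP : P ∈ SPD n)
    (hspan : Submodule.span ℝ (Set.range fun i => logMap P (R i)) ≠ ⊤) :
    ∃ k, R ∈ degenerateFamily ℓ k '' {x | x.1 ∈ SPD n} := by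
  have hne : (Submodule.span ℝ (Set.range fun i => logMap P (R i))).map
      (entriesEquiv n).symm.toLinearEquiv.toLinearMap ≠ ⊤ := fun h =>
    hspan <| Submodule.map_injective_of_injective (entriesEquiv n).symm.injective <|
      h.trans ((Submodule.map_top _).trans (LinearEquiv.range _)).symm
  obtain ⟨k, c, hk⟩ := exists_hyperplanePoint_of_ne_top hne
  refine ⟨k, (P, c, fun i j => (entriesEquiv n).symm (logMap P (R i)) j), hP, ?_⟩
  funext i
  have h1 := hk _ (Submodule.mem_map_of_mem (Submodule.subset_span (Set.mem_range_self i)))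
  have h2 : entriesEquiv n (hyperplanePoint k c
      fun j => (entriesEquiv n).symm (logMap P (R i)) j) = logMap P (R i) :=
    (congrArg (entriesEquiv n) h1).trans ((entriesEquiv n).apply_symm_apply _)
  have h3 : P.1 * NormedSpace.exp (P.1⁻¹ * (logMap P (R i)).1) = (R i).1 :=
    mul_exp_inv_mul_log hP (hR i)
  simp only [degenerateFamily]
  rw [h2, h3, symPart_coe]

theorem ae_span_logMap_eq_top (hℓ : 2 * (n * (n + 1) / 2) ≤ ℓ) :
    ∀ᵐ R ∂(Measure.pi fun _ : Fin ℓ => lebesgueSym n), (∀ i, R i ∈ SPD n) →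
      ∀ P ∈ SPD n, Submodule.span ℝ (Set.range fun i => logMap P (R i)) = ⊤ := by
  -- Instance search does not identify the norm topology of `Fin ℓ → SymMat n` with the product
  -- topology, for which the two instances are available.
  have : @BorelSpace (Fin ℓ → SymMat n) (@UniformSpace.toTopologicalSpace _
      PseudoMetricSpace.toUniformSpace) _ := inferInstanceAs (BorelSpace (Fin ℓ → SymMat n))
  have : @Measure.IsAddHaarMeasure (Fin ℓ → SymMat n) _ (@UniformSpace.toTopologicalSpace _
      PseudoMetricSpace.toUniformSpace) _ (Measure.pi fun _ : Fin ℓ => lebesgueSym n) :=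
    inferInstanceAs (Measure.IsAddHaarMeasure (Measure.pi fun _ : Fin ℓ => lebesgueSym n))
  have hnull (k : Sym2 (Fin n)) : (Measure.pi fun _ : Fin ℓ => lebesgueSym n)
      (degenerateFamily ℓ k '' {x | x.1 ∈ SPD n}) = 0 :=
    addHaar_image_eq_zero_of_finrank_lt _ (finrank_degenerateFamily_domain_lt hℓ k)
      fun _ hx => differentiableAt_degenerateFamily k hx
  have hae := ae_all_iff.2 fun k => measure_eq_zero_iff_ae_notMem.1 (hnull k)
  filter_upwards [hae] with R hR hRS P hP
  by_contra hspan
  obtain ⟨k, hk⟩ := mem_degenerateFamily_image_of_span_ne_top hRS hP hspan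
  exact hR k hk

end DegenerateConfigurations

/-! ### Local invertibility for almost every configuration -/

theorem mainTheorem4 (n ℓ : ℕ) (hℓ : 2 * (n * (n + 1) / 2) ≤ ℓ) :
    ∀ᵐ R ∂(Measure.pi fun _ : Fin ℓ => lebesgueSym n), (∀ i, R i ∈ SPD n) →
      rankDeficientSet R = ∅ ∧ ∀ P ∈ SPD n, IsLocallyInvertibleAt (frechetMap R) P := by
  filter_upwards [ae_span_logMap_eq_top hℓ] with R hspan hR
  refine ⟨Set.sdiff_eq_empty.2 fun P hP => ⟨hP, ?_⟩, fun P hP => ?_⟩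
  · rw [hspan hR P hP, finrank_top, finrank_symMat]
  · have hinj := fderiv_frechetMap_injective hR hP (hspan hR P hP)
    refine ⟨(contDiffAt_frechetMap hR hP).differentiableAt (by simp), ?_, ?_⟩
    · rw [LinearMap.finrank_range_of_inj hinj, finrank_symMat]
    · exact isLocalDiffeoOntoImageAt_of_injective_fderiv isOpen_SPD
        (fun Q hQ => (contDiffAt_frechetMap hR hQ).contDiffWithinAt) hP hinj
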